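/- Online bipartite matching with replacements. Let $S$ be a finite set of servers, given in advance, and let $n$ clients arrive one at a time, each with all its edges to $S$; at any time the current graph consists of the servers, the clients that have arrived, and all their edges. A matching is maintained, initially empty. An augmenting path from a client $c$ is a simple path from $c$ to a server in the current graph that alternates between unmatched and matched edges and whose two end vertices are unmatched. The protocol SAP does the following on the arrival of a client $c$: if there is an augmenting path from $c$ in the current graph, it chooses a shortest one (ties broken arbitrarily) and flips the matched status of all its edges; otherwise it does nothing. A replacement is made whenever a client that was already matched becomes matched to a different server. Theorem. SAP makes at most $O(n\log^2 n)$ replacements in total when $n$ clients are added. That is, there is an absolute constant $K$ such that for every $n\ge 0$ (with $n\log^2 n$ read as $0$ for $n=0$), every finite set of servers, every bipartite graph, every order of arrival of its $n$ clients and every way of breaking ties, the total number of replacements over the $n$ insertions is at most $K\,n\log^2 n$. Moreover, if $n\ge 2$, the total number of changes of the matched status of an edge (that is, the total length of the augmenting paths used) is also at most $K\,n\log^2 n$. -/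

import Mathlib

namespace OnlineMatching

/-- A bipartite graph with clients `C` and servers `S` is given by its adjacency relation
`E : C → S → Prop`; a set of client-server pairs is given as a `Set (C × S)`.

`AugmentingPath E M c` is the type of augmenting paths with respect to `M` in the graph `E` that
start at the client `c` and end at a free server: simple paths
`c = c₀, s₀, c₁, s₁, …, c_k, s_k`, where every edge `c_i s_i` is outside `M`, every edge
`s_i c_{i+1}` is in `M`, and both end vertices `c₀` and `s_k` are unmatched. -/
structure AugmentingPath {C S : Type*} (E : C → S → Prop) (M : Set (C × S)) (c : C) where
  /-- the number of matched edges on the path -/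
  k : ℕ
  client : Fin (k + 1) → C
  server : Fin (k + 1) → S
  client_zero : client 0 = c
  client_injective : Function.Injective client
  server_injective : Function.Injective server
  adj_forward : ∀ i : Fin (k + 1), E (client i) (server i)
  notMem_forward : ∀ i : Fin (k + 1), (client i, server i) ∉ M
  adj_backward : ∀ i : Fin k, E (client i.succ) (server i.castSucc)
  mem_backward : ∀ i : Fin k, (client i.succ, server i.castSucc) ∈ M
  start_free : ∀ s : S, (c, s) ∉ M
  end_free : ∀ c' : C, (c', server (Fin.last k)) ∉ M

namespace AugmentingPath

variable {C S : Type*} {E : C → S → Prop} {M : Set (C × S)} {c : C}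

/-- The length (number of edges) of an augmenting path. -/
def length (P : AugmentingPath E M c) : ℕ := 2 * P.k + 1

/-- The set of edges of an augmenting path. -/
def edges (P : AugmentingPath E M c) : Set (C × S) :=
  Set.range (fun i : Fin (P.k + 1) => (P.client i, P.server i)) ∪
    Set.range (fun i : Fin P.k => (P.client i.succ, P.server i.castSucc))

end AugmentingPath

/-- `SAPStep E M c M'`: when the client `c` arrives, `E` being the current graph and `M` the current
matching, the shortest augmenting path protocol may change the matching from `M` to `M'`. If there
is an augmenting path from `c`, the matched status of all edges on some shortest one is flipped
(ties broken arbitrarily); otherwise nothing changes. -/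
def SAPStep {C S : Type*} (E : C → S → Prop) (M : Set (C × S)) (c : C) (M' : Set (C × S)) : Prop :=
  (∃ P : AugmentingPath E M c,
      (∀ Q : AugmentingPath E M c, P.length ≤ Q.length) ∧ M' = symmDiff M P.edges) ∨
    (IsEmpty (AugmentingPath E M c) ∧ M' = M)

/-- The clients are `Fin n`, numbered in the order of their arrival. `currentGraph E t` is the graph
just after the arrival of client `t`: it has exactly the edges of `E` at clients that have
arrived. -/
def currentGraph {n : ℕ} {S : Type*} (E : Fin n → S → Prop) (t : Fin n) : Fin n → S → Prop :=
  fun c s => c ≤ t ∧ E c s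

/-- `M 0, M 1, …, M n` are the matchings maintained by an execution of the shortest augmenting
path protocol on the final graph `E`: `M t` is the matching after the first `t` arrivals. -/
structure IsSAPRun {n : ℕ} {S : Type*} (E : Fin n → S → Prop)
    (M : Fin (n + 1) → Set (Fin n × S)) : Prop where
  init : M 0 = ∅
  step : ∀ t : Fin n, SAPStep (currentGraph E t) (M t.castSucc) t (M t.succ)

/-- The number of replacements in passing from `M` to `M'`: the number of clients that are matched
in both, but to a different server. -/
noncomputable def replacements {C S : Type*} (M M' : Set (C × S)) : ℕ :=
  Set.ncard {c : C | ∃ s s' : S, (c, s) ∈ M ∧ (c, s') ∈ M' ∧ s ≠ s'}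

/-- The number of edges whose matched status differs between `M` and `M'`. -/
noncomputable def edgeChanges {C S : Type*} (M M' : Set (C × S)) : ℕ :=
  Set.ncard (symmDiff M M')

end OnlineMatching

namespace OnlineMatching

open Finset

/-! For `r` in `(0, 1)`, let the excess of the matched clients be the maximum of `|B| - r * |N(B)|`
over sets `B` of them, and fix a maximizer `B`. If all neighbours of the new client lie in `N(B)`,
matching it raises the excess by at least 1 (`excess_add_one_le`). Otherwise matched clients outside
`B` expand by a factor `1 / r` outside `N(B)`, so alternating search grows geometrically and soon
meets a free server (`exists_short_augmentingPath`).

By Hall's condition the excess never exceeds `(1 - r) * n`, which bounds the number of long paths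
(`IsSAPRun.card_long_le`). With `r = 1 - 2 * log n / m`, at most `2 * n * log n / m` paths have `k >
m`; summing over `m` gives a harmonic sum and the second logarithm. -/

/-- A set of client-server pairs in which no client and no server occurs twice. -/
structure IsMatching {C S : Type*} (M : Set (C × S)) : Prop where
  server_unique : ∀ {c s s'}, (c, s) ∈ M → (c, s') ∈ M → s = s'
  client_unique : ∀ {c c' s}, (c, s) ∈ M → (c', s) ∈ M → c = c'

/-! ### Flipping augmenting paths and shortening alternating walks -/

section Augmentation

variable {C S : Type*} {E : C → S → Prop} {M : Set (C × S)} {c : C}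

/-- The only matched edge at a client of the path is the path's own backward edge, so the flip just
moves each such client to its forward server. -/
theorem mem_symmDiff_edges_iff (hM : IsMatching M) (P : AugmentingPath E M c) (b : C) (s : S) :
    (b, s) ∈ symmDiff M P.edges ↔
      (∃ i, P.client i = b ∧ P.server i = s) ∨ (b ∉ Set.range P.client ∧ (b, s) ∈ M) := by
  constructor
  · rintro (⟨hbM, hbE⟩ | ⟨hbE, hbM⟩)
    · refine Or.inr ⟨?_, hbM⟩
      rintro ⟨i, rfl⟩
      induction i using Fin.cases with
      | zero => exact P.start_free s (P.client_zero ▸ hbM)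
      | succ j =>
        refine hbE (Or.inr ⟨j, ?_⟩)
        rw [hM.server_unique hbM (P.mem_backward j)]
    · rcases hbE with ⟨i, hi⟩ | ⟨i, hi⟩
      · exact Or.inl ⟨i, congrArg Prod.fst hi, congrArg Prod.snd hi⟩
      · exact absurd (hi ▸ P.mem_backward i) hbM
  · rintro (⟨i, rfl, rfl⟩ | ⟨hb, hbM⟩)
    · exact Or.inr ⟨Or.inl ⟨i, rfl⟩, P.notMem_forward i⟩
    · refine Or.inl ⟨hbM, ?_⟩
      rintro (⟨i, hi⟩ | ⟨i, hi⟩)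
      · exact hb ⟨i, congrArg Prod.fst hi⟩
      · exact hb ⟨i.succ, congrArg Prod.fst hi⟩

theorem IsMatching.symmDiff_edges (hM : IsMatching M) (P : AugmentingPath E M c) :
    IsMatching (symmDiff M P.edges) := by
  -- A matched server of the path is matched to the next client of the path.
  have key : ∀ i b, b ∉ Set.range P.client → (b, P.server i) ∉ M := by
    intro i b hb hbM
    induction i using Fin.lastCases with
    | last => exact P.end_free b hbM
    | cast j => exact hb ⟨j.succ, hM.client_unique (P.mem_backward j) hbM⟩
  constructor
  · intro b s s' h h'
    rw [mem_symmDiff_edges_iff hM] at h h'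
    rcases h with ⟨i, rfl, rfl⟩ | ⟨hb, h⟩ <;> rcases h' with ⟨j, hj, rfl⟩ | ⟨hb', h'⟩
    · rw [P.client_injective hj]
    · exact absurd ⟨i, rfl⟩ hb'
    · exact absurd ⟨j, hj⟩ hb
    · exact hM.server_unique h h'
  · intro b b' s h h'
    rw [mem_symmDiff_edges_iff hM] at h h'
    rcases h with ⟨i, rfl, rfl⟩ | ⟨hb, h⟩ <;> rcases h' with ⟨j, rfl, hj⟩ | ⟨hb', h'⟩
    · rw [P.server_injective hj]
    · exact absurd h' (key i _ hb')
    · exact absurd (hj ▸ h) (key j _ hb)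
    · exact hM.client_unique h h'

theorem matched_symmDiff_edges_iff (hM : IsMatching M) (P : AugmentingPath E M c) (b : C) :
    (∃ s, (b, s) ∈ symmDiff M P.edges) ↔ b = c ∨ ∃ s, (b, s) ∈ M := by
  simp only [mem_symmDiff_edges_iff hM]
  constructor
  · rintro ⟨s, ⟨i, rfl, rfl⟩ | ⟨-, h⟩⟩
    · induction i using Fin.cases with
      | zero => exact Or.inl P.client_zero
      | succ j => exact Or.inr ⟨_, P.mem_backward j⟩
    · exact Or.inr ⟨s, h⟩
  · intro h
    by_cases hb : b ∈ Set.range P.client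
    · obtain ⟨i, rfl⟩ := hb
      exact ⟨_, Or.inl ⟨i, rfl, rfl⟩⟩
    · rcases h with rfl | ⟨s, h⟩
      · exact absurd ⟨0, P.client_zero⟩ hb
      · exact ⟨s, Or.inr ⟨hb, h⟩⟩

theorem replacements_symmDiff_edges_le (hM : IsMatching M) (P : AugmentingPath E M c) :
    replacements M (symmDiff M P.edges) ≤ P.k := by
  have hsub : {b : C | ∃ s s' : S, (b, s) ∈ M ∧ (b, s') ∈ symmDiff M P.edges ∧ s ≠ s'} ⊆
      Set.range (fun i : Fin P.k => P.client i.succ) := by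
    rintro b ⟨s, s', h, h', hne⟩
    rcases (mem_symmDiff_edges_iff hM P b s').1 h' with ⟨i, rfl, rfl⟩ | ⟨-, h'⟩
    · induction i using Fin.cases with
      | zero => exact absurd (P.client_zero ▸ h) (P.start_free s)
      | succ j => exact ⟨j, rfl⟩
    · exact absurd (hM.server_unique h h') hne
  refine (Set.ncard_le_ncard hsub (Set.finite_range _)).trans ?_
  rw [← Set.image_univ]
  exact (Set.ncard_image_le Set.finite_univ).trans (by simp [Set.ncard_univ])

theorem edgeChanges_symmDiff_edges_le (P : AugmentingPath E M c) :
    edgeChanges M (symmDiff M P.edges) ≤ 2 * P.k + 1 := by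
  rw [edgeChanges, symmDiff_symmDiff_cancel_left, AugmentingPath.edges,
    ← Set.image_univ, ← Set.image_univ]
  refine (Set.ncard_union_le _ _).trans ?_
  have h1 := Set.ncard_image_le (f := fun i : Fin (P.k + 1) => (P.client i, P.server i))
    Set.finite_univ
  have h2 := Set.ncard_image_le
    (f := fun i : Fin P.k => (P.client i.succ, P.server i.castSucc)) Set.finite_univ
  simp only [Set.ncard_univ, Nat.card_eq_fintype_card, Fintype.card_fin] at h1 h2
  omega

theorem IsMatching.card_servers_le (hM : IsMatching M) {B : Finset C} {T : Finset S}
    (h : ∀ s ∈ T, ∃ b ∈ B, (b, s) ∈ M) : #T ≤ #B := by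
  rcases T.eq_empty_or_nonempty with rfl | ⟨s₁, hs₁⟩
  · simp
  have : Nonempty C := ⟨(h s₁ hs₁).choose⟩
  choose! g hgB hgM using h
  refine card_le_card_of_injOn g hgB fun s hs s' hs' heq => ?_
  exact hM.server_unique (hgM s hs) (heq ▸ hgM s' hs')

/-- A walk of servers that starts at a neighbour of the free client `c`, moves from a server to a
neighbour of the client matched to it and ends at a free server can be shortened to an augmenting
path. -/
theorem exists_augmentingPath_of_walk (hM : IsMatching M) (hME : ∀ b s, (b, s) ∈ M → E b s)
    (hc : ∀ s, (c, s) ∉ M) (m : ℕ)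
    (h : ∃ f : ℕ → S, E c (f 0) ∧ (∀ j < m, ∃ b, (b, f j) ∈ M ∧ E b (f (j + 1))) ∧
      ∀ b, (b, f m) ∉ M) :
    ∃ P : AugmentingPath E M c, P.k ≤ m := by
  classical
  have hex : ∃ m, ∃ f : ℕ → S, E c (f 0) ∧
      (∀ j < m, ∃ b, (b, f j) ∈ M ∧ E b (f (j + 1))) ∧ ∀ b, (b, f m) ∉ M := ⟨m, h⟩
  obtain ⟨f, hf0, hstep, hend⟩ := Nat.find_spec hex
  have hle : Nat.find hex ≤ m := Nat.find_min' hex h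
  have hmin : ∀ i < Nat.find hex, _ := fun i hi => Nat.find_min hex hi
  generalize Nat.find hex = k at *
  -- In a shortest walk no server repeats: otherwise the loop between the two visits could be cut
  -- out.
  have hinj : ∀ a b, a < b → b ≤ k → f a ≠ f b := by
    intro a b hab hbk heq
    refine hmin (k - (b - a)) (by omega)
      ⟨fun j => if j ≤ a then f j else f (j + (b - a)), by simpa using hf0, ?_, ?_⟩
    · intro j hj
      rcases lt_trichotomy j a with hja | rfl | hja
      · simpa [hja.le, Nat.succ_le_of_lt hja] using hstep j (by omega)
      · have := hstep b (by omega)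
        simp only [le_refl, if_true, Nat.not_succ_le_self, if_false]
        rwa [heq, show j + 1 + (b - j) = b + 1 by omega]
      · have := hstep (j + (b - a)) (by omega)
        simp only [show ¬ j ≤ a by omega, show ¬ j + 1 ≤ a by omega, if_false]
        rwa [show j + 1 + (b - a) = j + (b - a) + 1 by omega]
    · by_cases hka : k - (b - a) ≤ a
      · have hkb : k = b := by omega
        have hka' : k - (b - a) = a := by omega
        simp only [hka', le_refl, if_true]
        rw [heq, ← hkb]
        exact hend
      · simp only [hka, if_false]
        rwa [show k - (b - a) + (b - a) = k by omega]
  have hinj' : ∀ a b, a ≤ k → b ≤ k → f a = f b → a = b := by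
    intro a b ha hb hab
    rcases lt_trichotomy a b with h | h | h
    · exact absurd hab (hinj a b h hb)
    · exact h
    · exact absurd hab.symm (hinj b a h ha)
  choose g hg using fun j : Fin k => hstep j j.2
  refine ⟨{
    k := k
    client := Fin.cons c g
    server := fun i => f i
    client_zero := rfl
    client_injective := ?_
    server_injective := fun a b hab => Fin.ext (hinj' a b (by omega) (by omega) hab)
    adj_forward := ?_
    notMem_forward := ?_
    adj_backward := fun i => by simpa using hME _ _ (hg i).1
    mem_backward := fun i => by simpa using (hg i).1
    start_free := hc
    end_free := by simpa using hend }, hle⟩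
  · rw [Fin.cons_injective_iff]
    refine ⟨?_, fun a b hab => ?_⟩
    · rintro ⟨i, hi⟩
      exact hc _ (hi ▸ (hg i).1)
    · have h := (hg a).1
      rw [hab] at h
      exact Fin.ext (hinj' a b (by omega) (by omega) (hM.server_unique h (hg b).1))
  · intro i
    induction i using Fin.cases with
    | zero => simpa using hf0
    | succ j => simpa using (hg j).2
  · intro i
    induction i using Fin.cases with
    | zero => simpa using hc _
    | succ j =>
      intro h
      have := hM.server_unique (hg j).1 (by simpa using h)
      exact hinj j (j + 1) (by omega) (by omega) this

end Augmentation

/-! ### The excess and expansion outside a maximizer -/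

section Excess

open Classical in
/-- The servers adjacent to a client in `B`. -/
noncomputable def nbhd {C S : Type*} [Fintype S] (E : C → S → Prop) (B : Finset C) : Finset S :=
  univ.filter fun s => ∃ b ∈ B, E b s

/-- The largest value of `|B| - r * |N(B)|` over the sets `B` of clients in `A`. -/
noncomputable def excess {C S : Type*} [Fintype S] (E : C → S → Prop) (r : ℝ) (A : Finset C) : ℝ :=
  A.powerset.sup' ⟨∅, A.empty_mem_powerset⟩ fun B => (#B : ℝ) - r * #(nbhd E B)

variable {C S : Type*} [Fintype S] {E : C → S → Prop} {r : ℝ} {A B : Finset C}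

@[simp]
theorem mem_nbhd {s : S} : s ∈ nbhd E B ↔ ∃ b ∈ B, E b s := by
  simp [nbhd]

theorem le_excess (h : B ⊆ A) : (#B : ℝ) - r * #(nbhd E B) ≤ excess E r A :=
  le_sup' (fun B => (#B : ℝ) - r * #(nbhd E B)) (mem_powerset.2 h)

theorem exists_eq_excess (E : C → S → Prop) (r : ℝ) (A : Finset C) :
    ∃ B ⊆ A, excess E r A = #B - r * #(nbhd E B) := by
  obtain ⟨B, hB, h⟩ := exists_mem_eq_sup' (s := A.powerset) ⟨∅, A.empty_mem_powerset⟩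
    fun B => (#B : ℝ) - r * #(nbhd E B)
  exact ⟨B, mem_powerset.1 hB, h⟩

theorem excess_mono {A' : Finset C} (h : A ⊆ A') : excess E r A ≤ excess E r A' :=
  sup'_mono _ (powerset_mono.2 h) _

theorem excess_nonneg : 0 ≤ excess E r A := by
  simpa [nbhd] using le_excess (E := E) (r := r) (empty_subset A)

theorem IsMatching.card_le_card_nbhd {M : Set (C × S)} (hM : IsMatching M)
    (hME : ∀ b s, (b, s) ∈ M → E b s) (h : ∀ b ∈ B, ∃ s, (b, s) ∈ M) : #B ≤ #(nbhd E B) := by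
  rcases B.eq_empty_or_nonempty with rfl | ⟨b₁, hb₁⟩
  · simp
  have : Nonempty S := ⟨(h b₁ hb₁).choose⟩
  choose! g hg using h
  refine card_le_card_of_injOn g (fun b hb => ?_) fun b hb b' hb' heq => ?_
  · exact mem_nbhd.2 ⟨b, hb, hME _ _ (hg b hb)⟩
  · exact hM.client_unique (hg b hb) (heq ▸ hg b' hb')

/-- Hall's condition `|B| ≤ |N(B)|` gives `|B| - r * |N(B)| ≤ (1 - r) * |B|`. -/
theorem IsMatching.excess_le {M : Set (C × S)} (hM : IsMatching M)
    (hME : ∀ b s, (b, s) ∈ M → E b s) (h : ∀ b ∈ A, ∃ s, (b, s) ∈ M) (hr0 : 0 ≤ r) (hr1 : r ≤ 1) :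
    excess E r A ≤ (1 - r) * #A := by
  obtain ⟨B, hBA, hB⟩ := exists_eq_excess E r A
  have h1 : (#B : ℝ) ≤ #(nbhd E B) := by
    exact_mod_cast hM.card_le_card_nbhd hME fun b hb => h b (hBA hb)
  have h2 : (#B : ℝ) ≤ #A := by exact_mod_cast card_le_card hBA
  rw [hB]
  nlinarith [mul_le_mul_of_nonneg_left h1 hr0, mul_le_mul_of_nonneg_left h2 (sub_nonneg.2 hr1)]

/-- If `B` attains the excess of `A`, then a set of further clients in `A` expands by a factor
`1 / r` outside the neighbourhood of `B`. -/
theorem card_le_mul_card_sdiff_nbhd [DecidableEq C] [DecidableEq S] (hBA : B ⊆ A)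
    (hB : excess E r A = #B - r * #(nbhd E B)) {D : Finset C} (hDA : D ⊆ A) (hDB : Disjoint B D) :
    (#D : ℝ) ≤ r * #(nbhd E D \ nbhd E B) := by
  -- The set `B ∪ D` cannot beat the maximizer `B`.
  have h := le_excess (E := E) (r := r) (union_subset hBA hDA)
  have hN : nbhd E (B ∪ D) = nbhd E B ∪ (nbhd E D \ nbhd E B) := by
    rw [union_sdiff_self_eq_union]
    ext s
    simp only [mem_nbhd, mem_union, or_and_right, exists_or]
  rw [hN, card_union_of_disjoint hDB, card_union_of_disjoint disjoint_sdiff, hB] at h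
  push_cast at h
  linarith

/-- Adding `c` to `B` gains a client without enlarging the neighbourhood. -/
theorem excess_add_one_le [DecidableEq C] (hBA : B ⊆ A)
    (hB : excess E r A = #B - r * #(nbhd E B)) {c : C} (hc : c ∉ A)
    (hcB : ∀ s, E c s → s ∈ nbhd E B) : excess E r A + 1 ≤ excess E r (insert c A) := by
  have h := le_excess (E := E) (r := r) (insert_subset_insert c hBA)
  have hN : nbhd E (insert c B) = nbhd E B := by
    ext s
    constructor
    · intro hs
      obtain ⟨b, hb, hbs⟩ := mem_nbhd.1 hs
      rcases mem_insert.1 hb with rfl | hb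
      · exact hcB s hbs
      · exact mem_nbhd.2 ⟨b, hb, hbs⟩
    · intro hs
      obtain ⟨b, hb, hbs⟩ := mem_nbhd.1 hs
      exact mem_nbhd.2 ⟨b, mem_insert_of_mem hb, hbs⟩
  rw [hN, card_insert_of_notMem fun hcB => hc (hBA hcB)] at h
  push_cast at h
  linarith

/-- If a free client has a neighbour outside the neighbourhood of a set attaining the excess, then
it has a short augmenting path. -/
theorem exists_short_augmentingPath {M : Set (C × S)} (hM : IsMatching M)
    {G : C → S → Prop} (hMG : ∀ b s, (b, s) ∈ M → G b s) {c : C}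
    (hEG : ∀ b s, b = c ∨ b ∈ A → E b s → G b s) (hA : ∀ b, b ∈ A ↔ ∃ s, (b, s) ∈ M)
    (hME : ∀ b s, (b, s) ∈ M → E b s) (hc : c ∉ A) (hBA : B ⊆ A)
    (hB : excess E r A = #B - r * #(nbhd E B)) (hr : 0 < r) {s₀ : S} (hs₀ : E c s₀)
    (hs₀B : s₀ ∉ nbhd E B) {m : ℕ} (hm : r ^ m * #A < 1) :
    ∃ P : AugmentingPath G M c, P.k ≤ m := by
  classical
  by_contra hno
  -- Search layers: at least `r⁻¹ ^ i` servers outside `N(B)` are reached by walks of `i` steps.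
  have hlayer : ∀ i ≤ m, ∃ T : Finset S, 1 ≤ r ^ i * #T ∧ ∀ s ∈ T, s ∉ nbhd E B ∧
      ∃ f : ℕ → S, G c (f 0) ∧ (∀ j < i, ∃ b, (b, f j) ∈ M ∧ G b (f (j + 1))) ∧ f i = s := by
    intro i
    induction i with
    | zero =>
      exact fun _ => ⟨{s₀}, by simp, fun s hs => (mem_singleton.1 hs) ▸
        ⟨hs₀B, fun _ => s₀, hEG _ _ (Or.inl rfl) hs₀, by simp, rfl⟩⟩
    | succ i ih =>
      intro hi
      obtain ⟨T, hT, hTw⟩ := ih (by omega)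
      have hmatched : ∀ s ∈ T, ∃ b, (b, s) ∈ M := by
        intro s hs
        by_contra! hfree
        obtain ⟨-, f, h0, hstep, rfl⟩ := hTw s hs
        obtain ⟨P, hP⟩ := exists_augmentingPath_of_walk hM hMG
          (fun s hs => hc ((hA c).2 ⟨s, hs⟩)) i ⟨f, h0, hstep, hfree⟩
        exact hno ⟨P, by omega⟩
      let D := A.filter fun b => ∃ s ∈ T, (b, s) ∈ M
      have hTD : #T ≤ #D := hM.card_servers_le fun s hs => by
        obtain ⟨b, hb⟩ := hmatched s hs
        exact ⟨b, mem_filter.2 ⟨(hA b).2 ⟨s, hb⟩, s, hs, hb⟩, hb⟩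
      have hBD : Disjoint B D := by
        rw [disjoint_left]
        intro b hbB hbD
        obtain ⟨-, s, hs, hbs⟩ := mem_filter.1 hbD
        exact (hTw s hs).1 (mem_nbhd.2 ⟨b, hbB, hME _ _ hbs⟩)
      refine ⟨nbhd E D \ nbhd E B, ?_, ?_⟩
      · have h1 := card_le_mul_card_sdiff_nbhd hBA hB (filter_subset _ A) hBD
        have h2 : (#T : ℝ) ≤ #D := by exact_mod_cast hTD
        calc (1 : ℝ) ≤ r ^ i * #T := hT
          _ ≤ r ^ i * (r * #(nbhd E D \ nbhd E B)) := by gcongr; exact h2.trans h1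
          _ = _ := by ring
      · intro s hs
        obtain ⟨hsD, hsB⟩ := mem_sdiff.1 hs
        refine ⟨hsB, ?_⟩
        obtain ⟨b, hbD, hbs⟩ := mem_nbhd.1 hsD
        obtain ⟨hbA, s', hs', hbs'⟩ := mem_filter.1 hbD
        obtain ⟨-, f, h0, hstep, rfl⟩ := hTw s' hs'
        refine ⟨fun j => if j ≤ i then f j else s, by simpa using h0, ?_, by simp⟩
        intro j hj
        rcases (Nat.lt_succ_iff.1 hj).lt_or_eq with hj | rfl
        · simpa [hj.le, Nat.succ_le_of_lt hj] using hstep j hj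
        · exact ⟨b, by simpa using hbs', by simpa using hEG _ _ (Or.inr hbA) hbs⟩
  obtain ⟨T, hT, hTw⟩ := hlayer m le_rfl
  -- Layer `m` has no free server either, so `1 ≤ r ^ m * #T ≤ r ^ m * #A < 1`.
  have hTA : #T ≤ #A := hM.card_servers_le fun s hs => by
    by_contra! hfree
    obtain ⟨-, f, h0, hstep, rfl⟩ := hTw s hs
    exact hno (exists_augmentingPath_of_walk hM hMG (fun s hs => hc ((hA c).2 ⟨s, hs⟩)) m
      ⟨f, h0, hstep, fun b hb => hfree b ((hA b).2 ⟨_, hb⟩) hb⟩)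
  have hTA' : (#T : ℝ) ≤ #A := by exact_mod_cast hTA
  have := mul_le_mul_of_nonneg_left hTA' (pow_nonneg hr.le m)
  linarith

end Excess

/-! ### Executions of the protocol and growth of the excess -/

section Run

variable {n : ℕ} {S : Type*} {E : Fin n → S → Prop} {M : Fin (n + 1) → Set (Fin n × S)}

theorem IsSAPRun.invariant (h : IsSAPRun E M) (t : Fin (n + 1)) :
    IsMatching (M t) ∧ ∀ b s, (b, s) ∈ M t → E b s ∧ (b : ℕ) < t := by
  induction t using Fin.induction with
  | zero => rw [h.init]; exact ⟨⟨by simp, by simp⟩, by simp⟩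
  | succ t ih =>
    obtain ⟨hM, hE⟩ := ih
    rcases h.step t with ⟨P, -, hP⟩ | ⟨-, hP⟩
    · rw [hP]
      refine ⟨hM.symmDiff_edges P, fun b s hbs => ?_⟩
      rcases (mem_symmDiff_edges_iff hM P b s).1 hbs with ⟨i, rfl, rfl⟩ | ⟨-, hbs⟩
      · have := P.adj_forward i
        exact ⟨this.2, Nat.lt_succ_of_le this.1⟩
      · exact ⟨(hE b s hbs).1, (hE b s hbs).2.trans (by simp)⟩
    · rw [hP]
      exact ⟨hM, fun b s hbs => ⟨(hE b s hbs).1, (hE b s hbs).2.trans (by simp)⟩⟩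

open Classical in
/-- The clients matched by `M`. -/
noncomputable def matchedClients {C S : Type*} [Fintype C] (M : Set (C × S)) : Finset C :=
  univ.filter fun b => ∃ s, (b, s) ∈ M

@[simp]
theorem mem_matchedClients {C S : Type*} [Fintype C] {M : Set (C × S)} {b : C} :
    b ∈ matchedClients M ↔ ∃ s, (b, s) ∈ M := by
  simp [matchedClients]

theorem IsSAPRun.matchedClients_mono (h : IsSAPRun E M) (t : Fin n) :
    matchedClients (M t.castSucc) ⊆ matchedClients (M t.succ) := by
  intro b hb
  rcases h.step t with ⟨P, -, hP⟩ | ⟨-, hP⟩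
  · rw [mem_matchedClients] at hb ⊢
    rw [hP, matched_symmDiff_edges_iff (h.invariant _).1]
    exact Or.inr hb
  · rwa [hP]

/-- Half the length `k` of the augmenting path used at time `t`, with `k = 0` if there is none,
bounds the changes at time `t`; when it is large, the excess of the matched clients grows. -/
theorem IsSAPRun.exists_path_length [Fintype S] (h : IsSAPRun E M) (t : Fin n) :
    ∃ k : ℕ, k < n ∧ replacements (M t.castSucc) (M t.succ) ≤ k ∧
      edgeChanges (M t.castSucc) (M t.succ) ≤ 2 * k + 1 ∧
      ∀ (r : ℝ) (m : ℕ), 0 < r → r ^ m * n < 1 → m < k →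
        excess E r (matchedClients (M t.castSucc)) + 1 ≤
          excess E r (matchedClients (M t.succ)) := by
  classical
  obtain ⟨hM, hE⟩ := h.invariant t.castSucc
  rcases h.step t with ⟨P, hmin, hP⟩ | ⟨-, hP⟩
  · refine ⟨P.k, ?_, hP ▸ replacements_symmDiff_edges_le hM P,
      hP ▸ edgeChanges_symmDiff_edges_le P, ?_⟩
    · simpa using Fintype.card_le_of_injective _ P.client_injective
    · intro r m hr hrm hmk
      have hins : matchedClients (M t.succ) = insert t (matchedClients (M t.castSucc)) := by
        ext b
        rw [mem_insert, mem_matchedClients, mem_matchedClients, hP,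
          matched_symmDiff_edges_iff hM]
      have ht : t ∉ matchedClients (M t.castSucc) := by
        simpa using fun s => P.start_free s
      obtain ⟨B, hBA, hB⟩ := exists_eq_excess E r (matchedClients (M t.castSucc))
      rw [hins]
      refine excess_add_one_le hBA hB ht fun s hs => ?_
      by_contra hsB
      -- The excess uses the final graph `E`, so that its values at different times are comparable;
      -- the current graph agrees with `E` at all clients that matter here.
      have hG : ∀ b s, b = t ∨ b ∈ matchedClients (M t.castSucc) → E b s →
          currentGraph E t b s := by
        rintro b s (rfl | hb) hbs
        · exact ⟨le_rfl, hbs⟩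
        · obtain ⟨s', hs'⟩ := mem_matchedClients.1 hb
          exact ⟨(hE b s' hs').2.le, hbs⟩
      have hcard : ((#(matchedClients (M t.castSucc)) : ℕ) : ℝ) ≤ n := by
        exact_mod_cast (card_le_univ _).trans (by simp)
      obtain ⟨Q, hQ⟩ := exists_short_augmentingPath hM
        (fun b s hbs => ⟨(hE b s hbs).2.le, (hE b s hbs).1⟩) hG (fun b => mem_matchedClients)
        (fun b s hbs => (hE b s hbs).1) ht hBA hB hr hs hsB (m := m)
        ((mul_le_mul_of_nonneg_left hcard (pow_nonneg hr.le m)).trans_lt hrm)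
      have := hmin Q
      simp only [AugmentingPath.length] at this
      omega
  · refine ⟨0, t.pos, ?_,
      by simp [hP, edgeChanges], by simp⟩
    have hempty : {b | ∃ s s', (b, s) ∈ M t.castSucc ∧ (b, s') ∈ M t.castSucc ∧ s ≠ s'} = ∅ :=
      Set.eq_empty_of_forall_notMem fun b ⟨s, s', hs, hs', hne⟩ => hne (hM.server_unique hs hs')
    rw [hP, replacements, hempty, Set.ncard_empty]

/-! ### Counting long paths and summing the lengths -/

theorem sum_le_of_forall_add_le {n : ℕ} (a : Fin n → ℝ) (g : Fin (n + 1) → ℝ)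
    (h : ∀ t, g t.castSucc + a t ≤ g t.succ) : ∑ t, a t ≤ g (Fin.last n) - g 0 := by
  induction n with
  | zero => simp
  | succ n ih =>
    rw [Fin.sum_univ_castSucc]
    have h1 := ih (fun t => a t.castSucc) (fun t => g t.castSucc) fun t => h t.castSucc
    have h2 := h (Fin.last n)
    simp only [Fin.succ_last, Fin.castSucc_zero] at h1 h2
    linarith

/-- The excess is monotone, rises by at least 1 at each long path, starts nonnegative and ends at
most `(1 - r) * n`. -/
theorem IsSAPRun.card_long_le [Fintype S] (h : IsSAPRun E M) (k : Fin n → ℕ) {m : ℕ} {r : ℝ}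
    (hr0 : 0 ≤ r) (hr1 : r ≤ 1)
    (hk : ∀ t, m < k t → excess E r (matchedClients (M t.castSucc)) + 1 ≤
      excess E r (matchedClients (M t.succ))) :
    (#{t | m < k t} : ℝ) ≤ (1 - r) * n := by
  have h1 := sum_le_of_forall_add_le (fun t => if m < k t then (1 : ℝ) else 0)
    (fun t => excess E r (matchedClients (M t))) fun t => by
      split_ifs with ht
      · exact hk t ht
      · simpa using excess_mono (h.matchedClients_mono t)
  obtain ⟨hM, hE⟩ := h.invariant (Fin.last n)
  have h2 := hM.excess_le (fun b s hbs => (hE b s hbs).1)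
    (fun b (hb : b ∈ matchedClients (M (Fin.last n))) => mem_matchedClients.1 hb) hr0 hr1
  have h3 : (#(matchedClients (M (Fin.last n))) : ℝ) ≤ n := by
    exact_mod_cast (card_le_univ _).trans (by simp)
  have h4 := excess_nonneg (E := E) (r := r) (A := matchedClients (M 0))
  rw [sum_boole] at h1
  have := mul_le_mul_of_nonneg_left h3 (sub_nonneg.2 hr1)
  linarith

/-- A family of `n` numbers below `n` of which few are large has a small sum. -/
theorem sum_le_of_card_le {n : ℕ} (hn : 1 ≤ n) (k : Fin n → ℕ) (hk : ∀ t, k t < n) {a : ℝ}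
    (ha : 0 ≤ a) (h : ∀ m : ℕ, 1 ≤ m → (#{t | m < k t} : ℝ) ≤ a / m) :
    ((∑ t, k t : ℕ) : ℝ) ≤ n + a * (1 + Real.log n) := by
  have h1 : ∑ t, k t = ∑ m ∈ range n, #{t | m < k t} := by
    have : ∀ t, k t = ∑ m ∈ range n, if m < k t then 1 else 0 := by
      intro t
      rw [sum_boole, show (range n).filter (fun m => m < k t) = range (k t) by
        ext m; have := hk t; simp only [mem_filter, mem_range]; omega]
      simp
    rw [sum_congr rfl fun t _ => this t, sum_comm]
    exact sum_congr rfl fun m _ => by rw [sum_boole]; rfl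
  obtain ⟨N, rfl⟩ : ∃ N, n = N + 1 := ⟨n - 1, by omega⟩
  -- The term `m = 0`, not covered by `h`, is split off and bounded by `n`.
  rw [h1, sum_range_succ']
  have h0 : ((#{t | 0 < k t} : ℕ) : ℝ) ≤ (N + 1 : ℕ) := by
    exact_mod_cast (card_le_univ _).trans (by simp)
  have hH : ∑ m ∈ range N, (1 : ℝ) / (m + 1 : ℕ) ≤ 1 + Real.log (N + 1 : ℕ) := by
    have h2 := harmonic_le_one_add_log N
    rw [harmonic] at h2
    push_cast at h2 ⊢
    simp only [one_div]
    rcases Nat.eq_zero_or_pos N with rfl | hN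
    · simp
    · have : Real.log N ≤ Real.log (N + 1) := by
        apply Real.log_le_log
        · exact_mod_cast hN
        · linarith
      linarith
  have hS : ((∑ m ∈ range N, #{t | m + 1 < k t} : ℕ) : ℝ) ≤ a * (1 + Real.log (N + 1 : ℕ)) := by
    rw [Nat.cast_sum]
    calc _ ≤ ∑ m ∈ range N, a * (1 / (m + 1 : ℕ)) := sum_le_sum fun m _ => by
          rw [mul_one_div]; exact h (m + 1) (by omega)
      _ = a * ∑ m ∈ range N, (1 : ℝ) / (m + 1 : ℕ) := (mul_sum _ _ _).symm
      _ ≤ _ := mul_le_mul_of_nonneg_left hH ha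
  rw [Nat.cast_add]
  linarith

theorem IsSAPRun.exists_path_lengths_sum_le [Fintype S] (h : IsSAPRun E M) (hn : 2 ≤ n) :
    ∃ k : Fin n → ℕ, (∀ t, replacements (M t.castSucc) (M t.succ) ≤ k t) ∧
      (∀ t, edgeChanges (M t.castSucc) (M t.succ) ≤ 2 * k t + 1) ∧
      ((∑ t, k t : ℕ) : ℝ) ≤ n + 2 * n * Real.log n * (1 + Real.log n) := by
  choose k hkn hrep hedge hlong using h.exists_path_length
  refine ⟨k, hrep, hedge, ?_⟩
  have hn' : (2 : ℝ) ≤ n := by exact_mod_cast hn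
  have hlog : 0 < Real.log n := Real.log_pos (by linarith)
  refine sum_le_of_card_le (by omega) k hkn (by positivity) fun m hm => ?_
  have hm' : (1 : ℝ) ≤ m := by exact_mod_cast hm
  have hm0 : (0 : ℝ) < m := by linarith
  -- For small `m` the choice of `r` would not be positive, but the trivial bound `n` suffices.
  rcases le_or_gt 1 (2 * Real.log n / m) with he | he
  · calc ((#{t | m < k t} : ℕ) : ℝ) ≤ n := by exact_mod_cast (card_le_univ _).trans (by simp)
      _ ≤ n * (2 * Real.log n / m) := le_mul_of_one_le_right (by linarith) he
      _ = _ := by ring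
  · set e := 2 * Real.log n / m with hedef
    -- The factor 2 in `e` gives `(1 - e) ^ m ≤ n⁻²`, hence strict inequality after multiplying by
    -- `n`.
    have he0 : 0 < e := by positivity
    have hpow : (1 - e) ^ m * n < 1 := by
      have h1 : (1 - e) ^ m ≤ Real.exp (-e) ^ m :=
        pow_le_pow_left₀ (by linarith) (by linarith [Real.add_one_le_exp (-e)]) m
      have h2 : Real.exp (-e) ^ m = ((n : ℝ) ^ 2)⁻¹ := by
        rw [← Real.exp_nat_mul, show (m : ℝ) * -e = -(Real.log n + Real.log n) by
          rw [hedef]; field_simp; ring, Real.exp_neg, Real.exp_add, Real.exp_log (by linarith), sq]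
      calc (1 - e) ^ m * n ≤ ((n : ℝ) ^ 2)⁻¹ * n := by rw [← h2]; gcongr
        _ = (n : ℝ)⁻¹ := by field_simp
        _ < 1 := inv_lt_one_of_one_lt₀ (by linarith)
    have := h.card_long_le k (m := m) (r := 1 - e) (by linarith) (by linarith)
      fun t ht => hlong t (1 - e) m (by linarith) hpow ht
    calc ((#{t | m < k t} : ℕ) : ℝ) ≤ (1 - (1 - e)) * n := this
      _ = _ := by rw [hedef]; ring

end Run

end OnlineMatching

/-! ### The absolute constant -/

theorem theorem1 :
    ∃ K : ℝ, ∀ (n : ℕ) (S : Type*) [Finite S] (E : Fin n → S → Prop)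
      (M : Fin (n + 1) → Set (Fin n × S)), OnlineMatching.IsSAPRun E M →
        ((∑ t : Fin n, OnlineMatching.replacements (M t.castSucc) (M t.succ) : ℕ) : ℝ)
            ≤ K * (n * Real.log n ^ 2) ∧
        (2 ≤ n →
          ((∑ t : Fin n, OnlineMatching.edgeChanges (M t.castSucc) (M t.succ) : ℕ) : ℝ)
            ≤ K * (n * Real.log n ^ 2)) := by
  refine ⟨20, fun n S _ E M h => ?_⟩
  have := Fintype.ofFinite S
  rcases Nat.lt_or_ge n 2 with hn | hn
  · refine ⟨?_, fun hn' => absurd hn' (by omega)⟩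
    have hzero : ∑ t : Fin n, OnlineMatching.replacements (M t.castSucc) (M t.succ) = 0 := by
      refine Finset.sum_eq_zero fun t _ => ?_
      obtain ⟨k, hk, hrep, -⟩ := h.exists_path_length t
      omega
    rw [hzero, Nat.cast_zero]
    positivity
  · obtain ⟨k, hrep, hedge, hsum⟩ := h.exists_path_lengths_sum_le hn
    have hn' : (2 : ℝ) ≤ n := by exact_mod_cast hn
    have hlog : 0.69 ≤ Real.log n := by
      have := Real.log_le_log (by norm_num) hn'
      linarith [Real.log_two_gt_d9]
    have hrep' : ((∑ t : Fin n, OnlineMatching.replacements (M t.castSucc) (M t.succ) : ℕ) : ℝ) ≤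
        (∑ t, k t : ℕ) := by exact_mod_cast Finset.sum_le_sum fun t _ => hrep t
    have hedge' : ((∑ t : Fin n, OnlineMatching.edgeChanges (M t.castSucc) (M t.succ) : ℕ) : ℝ) ≤
        2 * (∑ t, k t : ℕ) + n := by
      have := Finset.sum_le_sum fun t (_ : t ∈ Finset.univ) => hedge t
      rw [Finset.sum_add_distrib, ← Finset.mul_sum] at this
      simp only [Finset.sum_const, Finset.card_univ, Fintype.card_fin, smul_eq_mul,
        mul_one] at this
      exact_mod_cast this
    -- The left side bounds `(2 * ∑ k + n) / n`; as `log n ≥ 0.69`, its lower-order terms are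
    -- absorbed by the constant 20.
    have hpoly : 3 + 4 * Real.log n * (1 + Real.log n) ≤ 20 * Real.log n ^ 2 := by
      nlinarith
    have hmul := mul_le_mul_of_nonneg_left hpoly (by linarith : (0 : ℝ) ≤ n)
    have hk0 : (0 : ℝ) ≤ (∑ t, k t : ℕ) := Nat.cast_nonneg _
    refine ⟨?_, fun _ => ?_⟩ <;> linarith
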